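/- For $z$ in the upper half-plane put $q = e^{2\pi i z}$ and, for even $k \ge 2$, let $$E_k(z) = 1 + \frac{2}{\zeta(1-k)} \sum_{n=1}^\infty \Big(\sum_{d \mid n} d^{k-1}\Big) q^n,$$ so that $E_2 = 1 - 24q - \cdots$, $E_4 = 1 + 240 q + \cdots$ and $E_6 = 1 - 504 q - \cdots$. Let $$\Delta = \frac{E_4^3 - E_6^2}{1728}$$ (which vanishes nowhere in the upper half-plane), and $$\varphi = \frac{\big(25E_4^4 - 49E_6^2E_4\big) + 48E_6E_4^2E_2 + \big(-49E_4^3 + 25E_6^2\big)E_2^2}{\Delta^2}.$$ Then for every real $t > 0$, the value $\varphi(it)$ is a real number and $$\varphi(it) < 0.$$ -/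

import Mathlib

noncomputable section

/-- The discriminant in the normalization `Δ = (E₄³ - E₆²) / 1728 = q - 24 q² + 252 q³ + ⋯`. -/
def modularDelta (z : UpperHalfPlane) : ℂ :=
  (ModularForm.E₄ z ^ 3 - ModularForm.E₆ z ^ 2) / 1728

/-- The weakly holomorphic quasimodular form `φ` of weight `-8` and depth `2`. Here `E₂`, `E₄`, `E₆`
are the level one Eisenstein series normalized to have constant term `1`, that is
`E₂ = 1 - 24 ∑ σ₁(n) qⁿ`, `E₄ = 1 + 240 ∑ σ₃(n) qⁿ`, `E₆ = 1 - 504 ∑ σ₅(n) qⁿ`. -/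
def phi (z : UpperHalfPlane) : ℂ :=
  let E₂ : ℂ := EisensteinSeries.E2 z
  let E₄ : ℂ := ModularForm.E₄ z
  let E₆ : ℂ := ModularForm.E₆ z
  ((25 * E₄ ^ 4 - 49 * E₆ ^ 2 * E₄) + 48 * E₆ * E₄ ^ 2 * E₂
    + (-49 * E₄ ^ 3 + 25 * E₆ ^ 2) * E₂ ^ 2) / modularDelta z ^ 2

/-- The point `i t` of the upper half plane, for `t > 0`. -/
def itPoint (t : ℝ) (ht : 0 < t) : UpperHalfPlane :=
  ⟨Complex.I * (t : ℂ), by simpa using ht⟩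

end

open UpperHalfPlane hiding I
open Real Complex Filter Topology Asymptotics
open EisensteinSeries ModularForm Derivative
open scoped Manifold MatrixGroups ModularForm

/-! Write D = q d/dq, A = E₂E₄ - E₆ and B = E₄² - E₂E₆. The numerator of φ is -F with F = 49E₄A² -
25B², and all values on the imaginary axis are real, so the claim is F > 0 there. Ramanujan's
equations give A = 3 DE₄ and B = -2 DE₆, both positive on the axis because E₄ and -E₆ have positive
higher coefficients. With C = 5E₄³ + 7E₆² - 12E₂E₄E₆ they also give DC = 11AB, DF = (7/6)E₂F +
(7/3)AC and DΔ = E₂Δ, hence D(FΔ^(-7/6)) = (7/3)ACΔ^(-7/6). On the axis d/dt = -2πD. So C decreases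
to 0 as t → ∞ and is positive; then FΔ^(-7/6) decreases as well, and tends to 0 because F = O(Δ²).
Hence F > 0. -/

/-! ### Behaviour at the cusp -/

/-- A function given by a `q`-expansion tends to its constant term at `i∞`. -/
theorem tendsto_atImInfty_of_hasSum_qExpansion {f : ℍ → ℂ} {c : ℕ → ℂ}
    (hf : ∀ τ : ℍ, HasSum (fun m ↦ c m • Function.Periodic.qParam 1 τ ^ m) (f τ)) :
    Tendsto f atImInfty (𝓝 (c 0)) := by
  have hq (τ : ℍ) : Function.Periodic.qParam 1 τ ≠ 0 := Function.Periodic.qParam_ne_zero _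
  have hg : IsBoundedAtImInfty fun τ : ℍ ↦ (f τ - c 0) / Function.Periodic.qParam 1 τ := by
    refine isBoundedAtImInfty_of_hasSum_qExpansion (c := fun m ↦ c (m + 1)) one_pos fun τ ↦ ?_
    have h1 := ((hasSum_nat_add_iff' 1).mpr (hf τ)).div_const (Function.Periodic.qParam 1 τ)
    simp only [Finset.range_one, Finset.sum_singleton, pow_zero, smul_eq_mul, mul_one] at h1
    refine h1.congr_fun fun m ↦ ?_
    have := hq τ
    simp only [smul_eq_mul, pow_succ]
    field_simp
  have h0 : Tendsto (fun τ : ℍ ↦ f τ - c 0) atImInfty (𝓝 0) := by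
    refine ((qParam_tendsto_atImInfty one_pos).zero_mul_isBoundedUnder_le
      (IsBigO.isBoundedUnder_le (α := ℍ) hg)).congr fun τ ↦ ?_
    exact mul_div_cancel₀ _ (hq τ)
  simpa using h0.add_const (c 0)

theorem tendsto_E2_atImInfty : Tendsto E2 atImInfty (𝓝 1) := by
  have := tendsto_atImInfty_of_hasSum_qExpansion fun τ ↦ by
    simpa only [Function.Periodic.qParam, ofReal_one, div_one] using hasSum_qExpansion_E2 (z := τ)
  simpa only [if_true] using this

theorem tendsto_E_atImInfty {k : ℕ} (hk : 3 ≤ k) (hk2 : Even k) :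
    Tendsto (E hk) atImInfty (𝓝 1) := by
  have := tendsto_atImInfty_of_hasSum_qExpansion (f := E hk) fun τ ↦
    ModularForm.hasSum_qExpansion (E hk) one_pos one_mem_strictPeriods_SL τ
  rwa [E_qExpansion_coeff_zero hk hk2] at this

theorem tendsto_E4_atImInfty : Tendsto E₄ atImInfty (𝓝 1) := tendsto_E_atImInfty _ ⟨2, rfl⟩

theorem tendsto_E6_atImInfty : Tendsto E₆ atImInfty (𝓝 1) := tendsto_E_atImInfty _ ⟨3, rfl⟩

/-- The normalized derivative of a holomorphic function bounded at `i∞` vanishes at `i∞`. -/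
theorem isZeroAtImInfty_normalizedDerivOfComplex {f : ℍ → ℂ} (hf : MDiff f)
    (hb : IsBoundedAtImInfty f) : IsZeroAtImInfty (normalizedDerivOfComplex f) := by
  obtain ⟨M, A, hM⟩ := isBoundedAtImInfty_iff.mp hb
  rw [isZeroAtImInfty_iff]
  intro ε hε
  set R : ℝ := max 1 (|M| / ε) with hR
  have hR1 : 1 ≤ R := le_max_left _ _
  have hR2 : |M| ≤ ε * R := by
    have := le_max_right 1 (|M| / ε)
    rw [div_le_iff₀ hε] at this
    linarith
  -- At this height the disc of radius `R` about `z` stays where `f` is bounded by `M`, so Cauchy's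
  -- estimate gives `|M| / R ≤ ε`.
  refine ⟨|A| + 2 * R, fun z hz ↦ ?_⟩
  have him (w : ℂ) (hw : w ∈ Metric.closedBall (z : ℂ) R) : |A| + R ≤ w.im := by
    have h1 : |(w - z).im| ≤ R :=
      (Complex.abs_im_le_norm _).trans (by simpa [dist_eq_norm] using hw)
    rw [sub_im, coe_im] at h1
    linarith [neg_le_of_abs_le h1]
  have hpos (w : ℂ) (hw : w ∈ Metric.closedBall (z : ℂ) R) : 0 < w.im := by
    linarith [him w hw, abs_nonneg A]
  have hd : DiffContOnCl ℂ (f ∘ ofComplex) (Metric.ball (z : ℂ) R) := by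
    refine DifferentiableOn.diffContOnCl fun w hw ↦ ?_
    have hw' := hpos w (Metric.closure_ball_subset_closedBall hw)
    exact ((UpperHalfPlane.mdifferentiable_iff.mp hf).differentiableAt
      (isOpen_upperHalfPlaneSet.mem_nhds hw')).differentiableWithinAt
  have hder : ‖deriv (f ∘ ofComplex) z‖ ≤ |M| / R := by
    refine Complex.norm_deriv_le_of_forall_mem_sphere_norm_le (by linarith) hd fun w hw ↦ ?_
    have hw' := Metric.sphere_subset_closedBall hw
    simp only [Function.comp_apply, ofComplex_apply_of_im_pos (hpos w hw')]
    refine (hM _ ?_).trans (le_abs_self M)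
    change A ≤ w.im
    linarith [him w hw', le_abs_self A]
  have h2 : ‖(2 * π * Complex.I)⁻¹‖ ≤ 1 := by
    have := Real.pi_gt_three
    simp only [norm_inv, norm_mul, Complex.norm_ofNat, norm_real, norm_I, mul_one,
      Real.norm_eq_abs, abs_of_pos pi_pos]
    exact inv_le_one_of_one_le₀ (by linarith)
  calc ‖normalizedDerivOfComplex f z‖ ≤ 1 * (|M| / R) := by
        rw [normalizedDerivOfComplex, norm_mul]
        gcongr
    _ ≤ ε := by rw [one_mul, div_le_iff₀ (by linarith)]; exact hR2

/-- A level one holomorphic function of weight less than twelve vanishing at `i∞` is zero. -/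
theorem eq_zero_of_slash_invariant_of_weight_lt_twelve {k : ℤ} (hk : k < 12) {f : ℍ → ℂ}
    (hf : MDiff f) (hs : ∀ γ : SL(2, ℤ), f ∣[k] γ = f) (h0 : IsZeroAtImInfty f) : f = 0 := by
  let g : CuspForm 𝒮ℒ k :=
    { toFun := f
      slash_action_eq' := by rintro _ ⟨γ, rfl⟩; exact hs γ
      holo' := hf
      zero_at_cusps' := fun hc ↦ by
        rw [Subgroup.IsArithmetic.isCusp_iff_isCusp_SL2Z] at hc
        rw [OnePoint.isZeroAt_iff_forall_SL2Z hc]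
        intro γ _
        rwa [hs γ] }
  have hg : g = 0 := rank_zero_iff_forall_zero.mp (CuspForm.rank_eq_zero_of_weight_lt_twelve hk) g
  exact congrArg DFunLike.coe hg

/-! ### Ramanujan's differential equations -/

theorem E4_slash (γ : SL(2, ℤ)) : (E₄ : ℍ → ℂ) ∣[(4 : ℤ)] γ = E₄ :=
  SlashInvariantForm.slash_action_eqn E₄ _ ⟨γ, rfl⟩

theorem E6_slash (γ : SL(2, ℤ)) : (E₆ : ℍ → ℂ) ∣[(6 : ℤ)] γ = E₆ :=
  SlashInvariantForm.slash_action_eqn E₆ _ ⟨γ, rfl⟩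

theorem tendsto_serreDerivative_atImInfty {f : ℍ → ℂ} (hf : MDiff f) {k c : ℂ}
    (h : Tendsto f atImInfty (𝓝 c)) :
    Tendsto (serreDerivative k f) atImInfty (𝓝 (-(k * 12⁻¹ * c))) := by
  have hD : Tendsto (normalizedDerivOfComplex f) atImInfty (𝓝 0) :=
    isZeroAtImInfty_normalizedDerivOfComplex hf (h.isBigO_one ℝ)
  have := hD.sub ((tendsto_E2_atImInfty.const_mul (k * 12⁻¹)).mul h)
  simpa using this

theorem normalizedDerivOfComplex_E4 (z : ℍ) :
    normalizedDerivOfComplex E₄ z = (E2 z * E₄ z - E₆ z) / 3 := by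
  have hE : MDiff (E₄ : ℍ → ℂ) := E₄.holo'
  -- The Serre derivative has constant term -4/12, which 1/3 cancels.
  have h0 : serreDerivative (4 : ℤ) E₄ + (1 / 3 : ℂ) • (E₆ : ℍ → ℂ) = 0 := by
    refine eq_zero_of_slash_invariant_of_weight_lt_twelve (k := 6) (by norm_num)
      ((serreDerivative_mdifferentiable _ hE).add (E₆.holo'.const_smul _)) (fun γ ↦ ?_) ?_
    · rw [SlashAction.add_slash, SL_smul_slash, E6_slash]
      congr 1
      exact serreDerivative_slash_invariant hE (E4_slash γ)
    · have := (tendsto_serreDerivative_atImInfty (k := (4 : ℤ)) hE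
        tendsto_E4_atImInfty).add
        (tendsto_E6_atImInfty.const_smul (1 / 3 : ℂ))
      refine this.trans_eq ?_
      norm_num
  have := congrFun h0 z
  simp at this
  linear_combination this

theorem normalizedDerivOfComplex_E6 (z : ℍ) :
    normalizedDerivOfComplex E₆ z = (E2 z * E₆ z - E₄ z ^ 2) / 2 := by
  have hE : MDiff (E₆ : ℍ → ℂ) := E₆.holo'
  have hE4 : MDiff (E₄ : ℍ → ℂ) := E₄.holo'
  have h0 : serreDerivative (6 : ℤ) E₆ + (1 / 2 : ℂ) • ((E₄ : ℍ → ℂ) * (E₄ : ℍ → ℂ)) = 0 := by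
    refine eq_zero_of_slash_invariant_of_weight_lt_twelve (k := 8) (by norm_num)
      ((serreDerivative_mdifferentiable _ hE).add ((hE4.mul hE4).const_smul _)) (fun γ ↦ ?_) ?_
    · rw [SlashAction.add_slash, SL_smul_slash, show (8 : ℤ) = 4 + 4 by norm_num, mul_slash_SL2,
        E4_slash]
      congr 1
      exact serreDerivative_slash_invariant hE (E6_slash γ)
    · have h4 := tendsto_E4_atImInfty
      have := (tendsto_serreDerivative_atImInfty (k := (6 : ℤ)) hE
        tendsto_E6_atImInfty).add ((h4.mul h4).const_smul (1 / 2 : ℂ))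
      refine this.trans_eq ?_
      norm_num
  have := congrFun h0 z
  simp at this
  linear_combination this

theorem normalizedDerivOfComplex_D2 (γ : SL(2, ℤ)) (z : ℍ) :
    normalizedDerivOfComplex (D2 γ) z = -(γ 1 0 / denom γ z) ^ 2 := by
  have hne : (γ 1 0 : ℂ) * z + γ 1 1 ≠ 0 := by
    simpa [denom] using denom_ne_zero (γ : GL (Fin 2) ℝ) z
  have hd : HasDerivAt (fun w : ℂ ↦ 2 * π * Complex.I * γ 1 0 / ((γ 1 0 : ℂ) * w + γ 1 1))
      (-(2 * π * Complex.I * γ 1 0 * γ 1 0) / ((γ 1 0 : ℂ) * z + γ 1 1) ^ 2) z := by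
    have h1 : HasDerivAt (fun w : ℂ ↦ (γ 1 0 : ℂ) * w + γ 1 1) (γ 1 0) z := by
      simpa using ((hasDerivAt_id (z : ℂ)).const_mul (γ 1 0 : ℂ)).add_const (γ 1 1 : ℂ)
    simpa using! (hasDerivAt_const (z : ℂ) (2 * π * Complex.I * γ 1 0)).div h1 hne
  have heq : (D2 γ ∘ ofComplex) =ᶠ[𝓝 (z : ℂ)]
      fun w : ℂ ↦ 2 * π * Complex.I * γ 1 0 / ((γ 1 0 : ℂ) * w + γ 1 1) := by
    filter_upwards [isOpen_upperHalfPlaneSet.mem_nhds z.im_pos] with w hw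
    simp [D2, denom, ofComplex_apply_of_im_pos hw]
  rw [normalizedDerivOfComplex, heq.deriv_eq, hd.deriv]
  have hπ : (π : ℂ) ≠ 0 := ofReal_ne_zero.mpr pi_ne_zero
  have hI := I_ne_zero
  simp [denom]
  field_simp
  simp

theorem mdifferentiable_D2 (γ : SL(2, ℤ)) : MDiff (D2 γ) := by
  rw [UpperHalfPlane.mdifferentiable_iff]
  intro z hz
  have hne : (γ 1 0 : ℂ) * z + γ 1 1 ≠ 0 := by
    simpa [denom] using denom_ne_zero (γ : GL (Fin 2) ℝ) ⟨z, hz⟩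
  have : DifferentiableAt ℂ
      (fun w : ℂ ↦ 2 * π * Complex.I * γ 1 0 / ((γ 1 0 : ℂ) * w + γ 1 1)) z := by
    fun_prop (disch := exact hne)
  refine (this.congr_of_eventuallyEq ?_).differentiableWithinAt
  filter_upwards [isOpen_upperHalfPlaneSet.mem_nhds hz] with w hw
  simp [D2, denom, ofComplex_apply_of_im_pos hw]

/-- With u = c/(cz + d), the anomalies of DE₂ and of E₂²/12 under γ are the same combination of uE₂
and u², thanks to ζ(2) = π²/6. The parameter is 1, not the weight 2, because E₂ is only
quasimodular. -/
theorem serreDerivative_E2_slash (γ : SL(2, ℤ)) :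
    serreDerivative 1 E2 ∣[(4 : ℤ)] γ = serreDerivative 1 E2 := by
  ext z
  have hsq : (serreDerivative 1 E2 ∣[(4 : ℤ)] γ) z =
      (normalizedDerivOfComplex E2 ∣[(4 : ℤ)] γ) z -
        12⁻¹ * ((E2 ∣[(2 : ℤ)] γ) z * (E2 ∣[(2 : ℤ)] γ) z) := by
    have := congrFun (mul_slash_SL2 2 2 γ E2 E2) z
    simp only [Pi.mul_apply] at this
    rw [← this]
    norm_num [ModularForm.SL_slash_apply, serreDerivative_apply]
    ring
  have hD := congrFun (normalizedDerivOfComplex_SL_slash (k := 2) (γ := γ) E2_mdifferentiable) z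
  have hE2 := E2_slash_action γ
  have hD' : normalizedDerivOfComplex (E2 ∣[(2 : ℤ)] γ) z = normalizedDerivOfComplex E2 z -
      (1 / (2 * riemannZeta 2)) * -(γ 1 0 / denom γ z) ^ 2 := by
    rw [hE2, normalizedDerivOfComplex_sub _ _ E2_mdifferentiable
      ((mdifferentiable_D2 γ).const_smul _), normalizedDerivOfComplex_smul _ _
      (mdifferentiable_D2 γ)]
    simp [normalizedDerivOfComplex_D2]
  rw [hsq]
  simp only [Pi.sub_apply, hD', show (2 : ℤ) + 2 = 4 from rfl] at hD
  rw [← sub_eq_zero] at hD ⊢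
  have hE2z := congrFun hE2 z
  simp only [Pi.sub_apply, Pi.smul_apply, smul_eq_mul, D2] at hE2z
  rw [hE2z] at hD ⊢
  rw [serreDerivative_apply]
  set u : ℂ := γ 1 0 / denom γ z with hu
  rw [mul_div_assoc, ← hu] at hD ⊢
  rw [riemannZeta_two] at hD ⊢
  have hπ : (π : ℂ) ≠ 0 := ofReal_ne_zero.mpr pi_ne_zero
  have hI := I_ne_zero
  have hI2 := I_sq
  field_simp at hD ⊢
  push_cast at hD
  grind

theorem normalizedDerivOfComplex_E2 (z : ℍ) :
    normalizedDerivOfComplex E2 z = (E2 z ^ 2 - E₄ z) / 12 := by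
  have h0 : serreDerivative 1 E2 + (1 / 12 : ℂ) • (E₄ : ℍ → ℂ) = 0 := by
    refine eq_zero_of_slash_invariant_of_weight_lt_twelve (k := 4) (by norm_num)
      ((serreDerivative_mdifferentiable _ E2_mdifferentiable).add (E₄.holo'.const_smul _))
      (fun γ ↦ ?_) ?_
    · rw [SlashAction.add_slash, SL_smul_slash, E4_slash,
        serreDerivative_E2_slash]
    · have := (tendsto_serreDerivative_atImInfty (k := 1) E2_mdifferentiable
        tendsto_E2_atImInfty).add
        (tendsto_E4_atImInfty.const_smul (1 / 12 : ℂ))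
      refine this.trans_eq ?_
      norm_num
  have := congrFun h0 z
  simp at this
  linear_combination this

/-! ### Positivity from the differential system -/

theorem pos_of_hasDerivAt_neg_of_tendsto_zero {f f' : ℝ → ℝ}
    (hf : ∀ t, 0 < t → HasDerivAt f (f' t) t) (hneg : ∀ t, 0 < t → f' t < 0)
    (h0 : Tendsto f atTop (𝓝 0)) {t : ℝ} (ht : 0 < t) : 0 < f t := by
  have hanti : StrictAntiOn f (Set.Ioi 0) := by
    refine strictAntiOn_of_deriv_neg (convex_Ioi 0)
      (fun s hs ↦ (hf s hs).continuousAt.continuousWithinAt) fun s hs ↦ ?_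
    rw [interior_Ioi] at hs
    rw [(hf s hs).deriv]
    exact hneg s hs
  have h1 : 0 ≤ f (t + 1) := by
    refine le_of_tendsto h0 ?_
    filter_upwards [eventually_ge_atTop (t + 1)] with s hs
    exact hanti.antitoneOn (Set.mem_Ioi.mpr (by linarith)) (Set.mem_Ioi.mpr (by linarith)) hs
  exact h1.trans_lt (hanti (Set.mem_Ioi.mpr ht) (Set.mem_Ioi.mpr (by linarith)) (by linarith))

/-- Solutions of Ramanujan's differential system along the imaginary axis satisfy
`0 < 49 E₄ (E₂ E₄ - E₆)² - 25 (E₄² - E₂ E₆)²`. -/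
theorem quadratic_form_pos_of_ramanujan_system {e2 e4 e6 : ℝ → ℝ}
    (h2 : ∀ t, 0 < t → HasDerivAt e2 (-2 * π * ((e2 t ^ 2 - e4 t) / 12)) t)
    (h4 : ∀ t, 0 < t → HasDerivAt e4 (-2 * π * ((e2 t * e4 t - e6 t) / 3)) t)
    (h6 : ∀ t, 0 < t → HasDerivAt e6 (-2 * π * ((e2 t * e6 t - e4 t ^ 2) / 2)) t)
    (l2 : Tendsto e2 atTop (𝓝 1)) (l4 : Tendsto e4 atTop (𝓝 1)) (l6 : Tendsto e6 atTop (𝓝 1))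
    (hA : ∀ t, 0 < t → 0 < e2 t * e4 t - e6 t) (hB : ∀ t, 0 < t → 0 < e4 t ^ 2 - e2 t * e6 t)
    (hΔ : ∀ t, 0 < t → e4 t ^ 3 - e6 t ^ 2 ≠ 0)
    (oA : (fun t ↦ e2 t * e4 t - e6 t) =O[atTop] fun t ↦ e4 t ^ 3 - e6 t ^ 2)
    (oB : (fun t ↦ e4 t ^ 2 - e2 t * e6 t) =O[atTop] fun t ↦ e4 t ^ 3 - e6 t ^ 2)
    {t : ℝ} (ht : 0 < t) :
    0 < 49 * e4 t * (e2 t * e4 t - e6 t) ^ 2 - 25 * (e4 t ^ 2 - e2 t * e6 t) ^ 2 := by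
  have hC (t : ℝ) (ht : 0 < t) :
      0 < 5 * e4 t ^ 3 + 7 * e6 t ^ 2 - 12 * (e2 t * e4 t * e6 t) := by
    refine pos_of_hasDerivAt_neg_of_tendsto_zero
      (f := fun t ↦ 5 * e4 t ^ 3 + 7 * e6 t ^ 2 - 12 * (e2 t * e4 t * e6 t))
      (f' := fun t ↦ -2 * π * (11 * ((e2 t * e4 t - e6 t) * (e4 t ^ 2 - e2 t * e6 t))))
      (fun s hs ↦ ?_) (fun s hs ↦ ?_) ?_ ht
    · refine (((((h4 s hs).fun_pow 3).const_mul 5).fun_add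
        (((h6 s hs).fun_pow 2).const_mul 7)).fun_sub
        ((((h2 s hs).fun_mul (h4 s hs)).fun_mul (h6 s hs)).const_mul 12)).congr_deriv ?_
      norm_num
      ring
    · have := mul_pos pi_pos (mul_pos (hA s hs) (hB s hs))
      linarith
    · have := (((l4.pow 3).const_mul 5).add ((l6.pow 2).const_mul 7)).sub
        (((l2.mul l4).mul l6).const_mul 12)
      norm_num at this
      exact this
  set Δ : ℝ → ℝ := fun t ↦ e4 t ^ 3 - e6 t ^ 2 with hΔdef
  set F : ℝ → ℝ := fun t ↦
    49 * e4 t * (e2 t * e4 t - e6 t) ^ 2 - 25 * (e4 t ^ 2 - e2 t * e6 t) ^ 2 with hF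
  -- This is |Δ|^(-7/6), since `Real.log` ignores sign; only Δ ≠ 0 is needed. The exponent cancels
  -- the term (7/6)E₂F in DF.
  set v : ℝ → ℝ := fun t ↦ Real.exp (-(7 / 6) * Real.log (Δ t)) with hv
  have dΔ (s : ℝ) (hs : 0 < s) : HasDerivAt Δ (-2 * π * (e2 s * Δ s)) s := by
    refine (((h4 s hs).fun_pow 3).fun_sub ((h6 s hs).fun_pow 2)).congr_deriv ?_
    simp only [hΔdef]
    norm_num
    ring
  have dv (s : ℝ) (hs : 0 < s) : HasDerivAt v (v s * (7 / 3 * π * e2 s)) s := by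
    refine ((((dΔ s hs).log (hΔ s hs)).const_mul (-(7 / 6))).exp).congr_deriv ?_
    have : Δ s ≠ 0 := hΔ s hs
    simp only [hv]
    field_simp
    ring
  have dF (s : ℝ) (hs : 0 < s) : HasDerivAt F (-2 * π * (7 / 6 * e2 s * F s +
      7 / 3 * ((e2 s * e4 s - e6 s) *
        (5 * e4 s ^ 3 + 7 * e6 s ^ 2 - 12 * (e2 s * e4 s * e6 s))))) s := by
    refine ((((h4 s hs).const_mul 49).fun_mul
      ((((h2 s hs).fun_mul (h4 s hs)).fun_sub (h6 s hs)).fun_pow 2)).fun_sub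
      ((((h4 s hs).fun_pow 2).fun_sub ((h2 s hs).fun_mul (h6 s hs))).fun_pow 2 |>.const_mul 25)).congr_deriv
        ?_
    simp only [hF]
    norm_num
    ring
  have hFv : 0 < F t * v t := by
    refine pos_of_hasDerivAt_neg_of_tendsto_zero (f := fun t ↦ F t * v t)
      (f' := fun s ↦ -(14 / 3 * π * ((e2 s * e4 s - e6 s) *
        (5 * e4 s ^ 3 + 7 * e6 s ^ 2 - 12 * (e2 s * e4 s * e6 s))) * v s))
      (fun s hs ↦ ?_) (fun s hs ↦ ?_) ?_ ht
    · refine ((dF s hs).fun_mul (dv s hs)).congr_deriv ?_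
      ring
    · have h1 := mul_pos (hA s hs) (hC s hs)
      have h2 : 0 < v s := Real.exp_pos _
      have := pi_pos
      have : 0 < 14 / 3 * π * ((e2 s * e4 s - e6 s) *
        (5 * e4 s ^ 3 + 7 * e6 s ^ 2 - 12 * (e2 s * e4 s * e6 s))) * v s := by positivity
      linarith
    -- A and B are O(Δ), so Fv = O(|Δ|^(2 - 7/6)) = O(|Δ|^(5/6)).
    · have oF : F =O[atTop] fun t ↦ Δ t ^ 2 := by
        have o4 : (fun t ↦ 49 * e4 t) =O[atTop] fun _ ↦ (1 : ℝ) := (l4.const_mul 49).isBigO_one ℝ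
        have o1 := o4.mul (oA.pow 2)
        simp only [one_mul] at o1
        exact o1.sub ((oB.pow 2).const_mul_left 25)
      have lΔ : Tendsto Δ atTop (𝓝[≠] 0) := by
        refine tendsto_nhdsWithin_iff.mpr ⟨?_, ?_⟩
        · simpa using (l4.pow 3).sub (l6.pow 2)
        · filter_upwards [eventually_gt_atTop 0] with s hs using hΔ s hs
      have llog : Tendsto (fun t ↦ Real.exp (5 / 6 * Real.log (Δ t))) atTop (𝓝 0) :=
        Real.tendsto_exp_atBot.comp
          ((Real.tendsto_log_nhdsNE_zero.comp lΔ).const_mul_atBot (by norm_num))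
      refine IsBigO.trans_tendsto ?_ llog
      refine (oF.mul (isBigO_refl v atTop)).congr' EventuallyEq.rfl ?_
      filter_upwards [eventually_gt_atTop 0] with s hs
      have h3 : Δ s ^ 2 = Real.exp (2 * Real.log (Δ s)) := by
        rw [← sq_abs, ← Real.exp_log_eq_abs (hΔ s hs), ← Real.exp_nat_mul]
        rfl
      rw [h3, hv, ← Real.exp_add]
      ring_nf
  exact pos_of_mul_pos_left hFv (Real.exp_pos _).le

/-! ### Restriction to the imaginary axis -/

/-- The real part of the restriction of a function on `ℍ` to the imaginary axis. -/
noncomputable def imAxisRe (F : ℍ → ℂ) (t : ℝ) : ℝ := (F (ofComplex (Complex.I * t))).re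

theorem coe_ofComplex_I_mul {t : ℝ} (ht : 0 < t) :
    (ofComplex (Complex.I * t) : ℂ) = Complex.I * t := by
  rw [ofComplex_apply_of_im_pos (by simpa using ht)]

theorem hasDerivAt_imAxisRe {F : ℍ → ℂ} (hF : MDiff F) {t : ℝ} (ht : 0 < t) :
    HasDerivAt (imAxisRe F) (-2 * π * imAxisRe (normalizedDerivOfComplex F) t) t := by
  have h1 := (UpperHalfPlane.mdifferentiableAt_iff.mp
    (hF (ofComplex (Complex.I * t)))).hasDerivAt
  rw [coe_ofComplex_I_mul ht] at h1
  have h2 : HasDerivAt (fun s : ℝ ↦ Complex.I * (s : ℂ)) Complex.I t := by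
    simpa using (hasDerivAt_id t).ofReal_comp.const_mul Complex.I
  have h3 := (Complex.reCLM.hasFDerivAt.comp_hasDerivAt t (h1.comp t h2))
  refine h3.congr_deriv ?_
  have hI := I_ne_zero
  have hπ : (π : ℂ) ≠ 0 := ofReal_ne_zero.mpr pi_ne_zero
  have h4 : deriv (F ∘ ofComplex) (Complex.I * t) * Complex.I =
      ((-2 * π : ℝ) : ℂ) * normalizedDerivOfComplex F (ofComplex (Complex.I * t)) := by
    rw [normalizedDerivOfComplex, coe_ofComplex_I_mul ht]
    push_cast
    field_simp
    linear_combination (deriv (F ∘ ofComplex) (Complex.I * t)) * I_sq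
  rw [h4]
  simp [imAxisRe]

theorem tendsto_ofComplex_I_mul :
    Tendsto (fun t : ℝ ↦ ofComplex (Complex.I * t)) atTop atImInfty := by
  refine tendsto_comap_iff.mpr (tendsto_id.congr' ?_)
  filter_upwards [eventually_gt_atTop 0] with t ht
  have := congrArg Complex.im (coe_ofComplex_I_mul ht)
  simpa using this.symm

theorem tendsto_imAxisRe {F : ℍ → ℂ} {c : ℂ} (h : Tendsto F atImInfty (𝓝 c)) :
    Tendsto (imAxisRe F) atTop (𝓝 c.re) :=
  (Complex.continuous_re.tendsto c).comp (h.comp tendsto_ofComplex_I_mul)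

theorem qParam_ofComplex_I_mul {t : ℝ} (ht : 0 < t) :
    Function.Periodic.qParam 1 (ofComplex (Complex.I * t)) = (Real.exp (-2 * π * t) : ℂ) := by
  rw [coe_ofComplex_I_mul ht, Function.Periodic.qParam]
  push_cast
  congr 1
  linear_combination (2 * π * t) * I_sq

section RealQExpansion

variable {F : ℍ → ℂ} {a : ℕ → ℝ} {t : ℝ}

theorem hasSum_imAxis
    (hF : ∀ τ : ℍ, HasSum (fun m ↦ (a m : ℂ) • Function.Periodic.qParam 1 τ ^ m) (F τ))
    (ht : 0 < t) :
    HasSum (fun m ↦ ((a m * Real.exp (-2 * π * t) ^ m : ℝ) : ℂ))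
      (F (ofComplex (Complex.I * t))) := by
  refine (hF _).congr_fun fun m ↦ ?_
  rw [qParam_ofComplex_I_mul ht]
  simp

theorem hasSum_imAxisRe
    (hF : ∀ τ : ℍ, HasSum (fun m ↦ (a m : ℂ) • Function.Periodic.qParam 1 τ ^ m) (F τ))
    (ht : 0 < t) : HasSum (fun m ↦ a m * Real.exp (-2 * π * t) ^ m) (imAxisRe F t) := by
  exact (hasSum_imAxis hF ht).mapL Complex.reCLM

theorem ofReal_imAxisRe
    (hF : ∀ τ : ℍ, HasSum (fun m ↦ (a m : ℂ) • Function.Periodic.qParam 1 τ ^ m) (F τ))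
    (ht : 0 < t) : (imAxisRe F t : ℂ) = F (ofComplex (Complex.I * t)) :=
  (Complex.hasSum_ofReal.mpr (hasSum_imAxisRe hF ht)).unique (hasSum_imAxis hF ht)

theorem lt_of_hasSum_exp_of_nonneg {g : ℝ → ℝ}
    (hg : ∀ t, 0 < t → HasSum (fun m ↦ a m * Real.exp (-2 * π * t) ^ m) (g t))
    (ha : ∀ m, 0 ≤ a (m + 1)) (ha1 : 0 < a 1) (ht : 0 < t) : a 0 < g t := by
  have h := (hasSum_nat_add_iff' 1).mpr (hg t ht)
  simp only [Finset.range_one, Finset.sum_singleton, pow_zero, mul_one] at h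
  have h1 : a 1 * Real.exp (-2 * π * t) ^ 1 ≤ g t - a 0 :=
    le_hasSum h 0 fun m _ ↦ mul_nonneg (ha m) (pow_nonneg (Real.exp_pos _).le _)
  have : 0 < a 1 * Real.exp (-2 * π * t) ^ 1 := by positivity
  linarith

/-- A series in `exp (-2 π t)` with nonnegative coefficients and positive linear coefficient has
negative derivative. -/
theorem deriv_neg_of_hasSum_exp_of_nonneg {g : ℝ → ℝ}
    (hg : ∀ t, 0 < t → HasSum (fun m ↦ a m * Real.exp (-2 * π * t) ^ m) (g t))
    (ha : ∀ m, 0 ≤ a (m + 1)) (ha1 : 0 < a 1) (ht : 0 < t) {g' : ℝ} (hd : HasDerivAt g g' t) :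
    g' < 0 := by
  -- Dividing g - a₀ by q leaves nonnegative coefficients, hence a function still antitone in s. The
  -- product rule then gives g' ≤ -2π(g - a₀) < 0 without termwise differentiation.
  have hs (s : ℝ) (hs : 0 < s) : HasSum (fun m ↦ a (m + 1) * Real.exp (-2 * π * s) ^ m)
      ((g s - a 0) * Real.exp (2 * π * s)) := by
    have h := ((hasSum_nat_add_iff' 1).mpr (hg s hs)).mul_right (Real.exp (2 * π * s))
    simp only [Finset.range_one, Finset.sum_singleton, pow_zero, mul_one] at h
    refine h.congr_fun fun m ↦ ?_
    have : Real.exp (-2 * π * s) * Real.exp (2 * π * s) = 1 := by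
      rw [← Real.exp_add]; simp
    rw [pow_succ]
    linear_combination -(a (m + 1) * Real.exp (-2 * π * s) ^ m) * this
  have hanti : AntitoneOn (fun s ↦ (g s - a 0) * Real.exp (2 * π * s)) (Set.Ioi 0) := by
    intro r hr s hs' hrs
    refine hasSum_le (fun m ↦ ?_) (hs s hs') (hs r hr)
    refine mul_le_mul_of_nonneg_left (pow_le_pow_left₀ (Real.exp_pos _).le
      (Real.exp_le_exp.mpr ?_) _) (ha m)
    have := pi_pos
    nlinarith
  have he : HasDerivAt (fun s ↦ Real.exp (2 * π * s)) (Real.exp (2 * π * t) * (2 * π)) t := by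
    simpa using ((hasDerivAt_id t).const_mul (2 * π)).exp
  have hd2 := (hd.sub_const (a 0)).fun_mul he
  have h1 := hanti.derivWithin_nonpos (x := t)
  rw [hd2.hasDerivWithinAt.derivWithin (isOpen_Ioi.uniqueDiffWithinAt ht)] at h1
  have h2 : (g' + 2 * π * (g t - a 0)) * Real.exp (2 * π * t) ≤ 0 := by linarith
  have h3 : g' + 2 * π * (g t - a 0) ≤ 0 := nonpos_of_mul_nonpos_left h2 (Real.exp_pos _)
  have h4 := mul_pos pi_pos (sub_pos.mpr (lt_of_hasSum_exp_of_nonneg hg ha ha1 ht))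
  linarith

end RealQExpansion

/-! ### Eisenstein coefficients and decay at the cusp -/

/-- The coefficients `1, c σₖ(1), c σₖ(2), …` of a normalized Eisenstein series. -/
noncomputable def eisensteinCoeff (c : ℝ) (k m : ℕ) : ℝ :=
  if m = 0 then 1 else c * ArithmeticFunction.sigma k m

theorem hasSum_E2_qParam (τ : ℍ) : HasSum (fun m ↦ (eisensteinCoeff (-24) 1 m : ℂ) •
    Function.Periodic.qParam 1 τ ^ m) (E2 τ) := by
  have := hasSum_qExpansion_E2 (z := τ)
  refine this.congr_fun fun m ↦ ?_
  simp [eisensteinCoeff, Function.Periodic.qParam, apply_ite Complex.ofReal]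

theorem hasSum_E4_qParam (τ : ℍ) : HasSum (fun m ↦ (eisensteinCoeff 240 3 m : ℂ) •
    Function.Periodic.qParam 1 τ ^ m) (E₄ τ) := by
  refine (ModularForm.hasSum_qExpansion E₄ one_pos one_mem_strictPeriods_SL τ).congr_fun
    fun m ↦ ?_
  rw [E_qExpansion_coeff _ ⟨2, rfl⟩, show bernoulli 4 = -1 / 30 by decide +kernel]
  norm_num [eisensteinCoeff, apply_ite Complex.ofReal]

theorem hasSum_E6_qParam (τ : ℍ) : HasSum (fun m ↦ (eisensteinCoeff (-504) 5 m : ℂ) •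
    Function.Periodic.qParam 1 τ ^ m) (E₆ τ) := by
  refine (ModularForm.hasSum_qExpansion E₆ one_pos one_mem_strictPeriods_SL τ).congr_fun
    fun m ↦ ?_
  rw [E_qExpansion_coeff _ ⟨3, rfl⟩, show bernoulli 6 = 1 / 42 by decide +kernel]
  norm_num [eisensteinCoeff, apply_ite Complex.ofReal]

theorem periodic_E2 : Function.Periodic (E2 ∘ ofComplex) 1 := by
  intro w
  by_cases! hw : 0 < w.im
  · have hw' : 0 < (w + 1).im := by simpa using hw
    simp only [Function.comp_apply, ofComplex_apply_of_im_pos hw, ofComplex_apply_of_im_pos hw']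
    refine (hasSum_E2_qParam ⟨w + 1, hw'⟩).unique ?_
    convert hasSum_E2_qParam ⟨w, hw⟩ using 4
    simp [Function.Periodic.qParam, mul_add, Complex.exp_add, Complex.exp_two_pi_mul_I]
  · have hw' : (w + 1).im ≤ 0 := by simpa using hw
    simp only [Function.comp_apply, ofComplex_apply_of_im_nonpos hw,
      ofComplex_apply_of_im_nonpos hw']

theorem E2_sub_one_isBigO :
    (fun τ ↦ E2 τ - 1) =O[atImInfty] fun τ : ℍ ↦ Real.exp (-2 * π * τ.im) := by
  have := exp_decay_sub_atImInfty one_pos (by simpa using periodic_E2) E2_mdifferentiable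
    isBoundedAtImInfty_E2
  rw [valueAtInfty, tendsto_E2_atImInfty.limUnder_eq] at this
  simpa using this

theorem E4_sub_one_isBigO :
    (fun τ ↦ E₄ τ - 1) =O[atImInfty] fun τ : ℍ ↦ Real.exp (-2 * π * τ.im) := by
  have := exp_decay_sub_atImInfty (f := E₄) one_pos
    (SlashInvariantFormClass.periodic_comp_ofComplex E₄ one_mem_strictPeriods_SL) E₄.holo'
    (tendsto_E4_atImInfty.isBigO_one ℝ)
  rw [valueAtInfty, tendsto_E4_atImInfty.limUnder_eq] at this
  simpa using this

theorem E6_sub_one_isBigO :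
    (fun τ ↦ E₆ τ - 1) =O[atImInfty] fun τ : ℍ ↦ Real.exp (-2 * π * τ.im) := by
  have := exp_decay_sub_atImInfty (f := E₆) one_pos
    (SlashInvariantFormClass.periodic_comp_ofComplex E₆ one_mem_strictPeriods_SL) E₆.holo'
    (tendsto_E6_atImInfty.isBigO_one ℝ)
  rw [valueAtInfty, tendsto_E6_atImInfty.limUnder_eq] at this
  simpa using this

/-- The constant terms cancel, leaving O(|q|), and |q| = O(Δ) at the cusp. -/
theorem E2_mul_E4_sub_E6_isBigO_discriminant :
    (fun τ ↦ E2 τ * E₄ τ - E₆ τ) =O[atImInfty] discriminant := by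
  refine IsBigO.trans ?_ exp_isBigO_discriminant
  have h1 := E2_sub_one_isBigO.mul (tendsto_E4_atImInfty.isBigO_one ℝ)
  simp only [mul_one] at h1
  exact ((h1.add E4_sub_one_isBigO).sub E6_sub_one_isBigO).congr_left fun τ ↦ by ring

theorem E4_sq_sub_E2_mul_E6_isBigO_discriminant :
    (fun τ ↦ E₄ τ ^ 2 - E2 τ * E₆ τ) =O[atImInfty] discriminant := by
  refine IsBigO.trans ?_ exp_isBigO_discriminant
  have h1 := E4_sub_one_isBigO.mul ((tendsto_E4_atImInfty.add_const 1).isBigO_one ℝ)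
  have h2 := E2_sub_one_isBigO.mul (tendsto_E6_atImInfty.isBigO_one ℝ)
  simp only [mul_one] at h1 h2
  exact ((h1.sub h2).sub E6_sub_one_isBigO).congr_left fun τ ↦ by ring

/-! ### Eisenstein series on the imaginary axis -/

section ImaginaryAxis

variable {t : ℝ}

theorem ofReal_imAxisRe_E2 (ht : 0 < t) :
    (imAxisRe E2 t : ℂ) = E2 (ofComplex (Complex.I * t)) := ofReal_imAxisRe hasSum_E2_qParam ht

theorem ofReal_imAxisRe_E4 (ht : 0 < t) :
    (imAxisRe E₄ t : ℂ) = E₄ (ofComplex (Complex.I * t)) := ofReal_imAxisRe hasSum_E4_qParam ht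

theorem ofReal_imAxisRe_E6 (ht : 0 < t) :
    (imAxisRe E₆ t : ℂ) = E₆ (ofComplex (Complex.I * t)) := ofReal_imAxisRe hasSum_E6_qParam ht

theorem hasDerivAt_imAxisRe_E2 (ht : 0 < t) : HasDerivAt (imAxisRe E2)
    (-2 * π * ((imAxisRe E2 t ^ 2 - imAxisRe E₄ t) / 12)) t := by
  refine (hasDerivAt_imAxisRe E2_mdifferentiable ht).congr_deriv ?_
  congr 1
  rw [← ofReal_re ((_ : ℝ) / 12), imAxisRe, normalizedDerivOfComplex_E2, ← ofReal_imAxisRe_E2 ht,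
    ← ofReal_imAxisRe_E4 ht]
  norm_cast

theorem hasDerivAt_imAxisRe_E4 (ht : 0 < t) : HasDerivAt (imAxisRe E₄)
    (-2 * π * ((imAxisRe E2 t * imAxisRe E₄ t - imAxisRe E₆ t) / 3)) t := by
  refine (hasDerivAt_imAxisRe (F := E₄) E₄.holo' ht).congr_deriv ?_
  congr 1
  rw [← ofReal_re ((_ : ℝ) / 3), imAxisRe, normalizedDerivOfComplex_E4, ← ofReal_imAxisRe_E2 ht,
    ← ofReal_imAxisRe_E4 ht, ← ofReal_imAxisRe_E6 ht]
  norm_cast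

theorem hasDerivAt_imAxisRe_E6 (ht : 0 < t) : HasDerivAt (imAxisRe E₆)
    (-2 * π * ((imAxisRe E2 t * imAxisRe E₆ t - imAxisRe E₄ t ^ 2) / 2)) t := by
  refine (hasDerivAt_imAxisRe (F := E₆) E₆.holo' ht).congr_deriv ?_
  congr 1
  rw [← ofReal_re ((_ : ℝ) / 2), imAxisRe, normalizedDerivOfComplex_E6, ← ofReal_imAxisRe_E2 ht,
    ← ofReal_imAxisRe_E4 ht, ← ofReal_imAxisRe_E6 ht]
  norm_cast

/-- Positive coefficients make E₄(it) decrease, and its derivative is -2πA/3. -/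
theorem imAxisRe_E2_mul_E4_sub_E6_pos (ht : 0 < t) :
    0 < imAxisRe E2 t * imAxisRe E₄ t - imAxisRe E₆ t := by
  have h := deriv_neg_of_hasSum_exp_of_nonneg (fun t ht ↦ hasSum_imAxisRe hasSum_E4_qParam ht)
    (fun m ↦ by simp only [eisensteinCoeff]; positivity) (by simp [eisensteinCoeff]) ht
    (hasDerivAt_imAxisRe_E4 ht)
  have := pi_pos
  by_contra! hle
  nlinarith

theorem imAxisRe_E4_sq_sub_E2_mul_E6_pos (ht : 0 < t) :
    0 < imAxisRe E₄ t ^ 2 - imAxisRe E2 t * imAxisRe E₆ t := by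
  have h := deriv_neg_of_hasSum_exp_of_nonneg (a := fun m ↦ -eisensteinCoeff (-504) 5 m)
    (g := fun t ↦ -imAxisRe E₆ t)
    (fun t ht ↦ by simpa only [neg_mul] using (hasSum_imAxisRe hasSum_E6_qParam ht).neg)
    (fun m ↦ by
      simp only [eisensteinCoeff, Nat.add_eq_zero_iff, one_ne_zero, and_false, if_false, neg_mul,
        neg_neg]
      positivity)
    (by simp [eisensteinCoeff]) ht (hasDerivAt_imAxisRe_E6 ht).fun_neg
  have := pi_pos
  by_contra! hle
  nlinarith

theorem ofReal_imAxisRe_discriminant (ht : 0 < t) :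
    ((imAxisRe E₄ t ^ 3 - imAxisRe E₆ t ^ 2 : ℝ) : ℂ) =
      1728 * discriminant (ofComplex (Complex.I * t)) := by
  rw [discriminant_eq_E₄_cube_sub_E₆_sq, ← ofReal_imAxisRe_E4 ht, ← ofReal_imAxisRe_E6 ht]
  push_cast
  ring

theorem imAxisRe_E4_cube_sub_E6_sq_ne_zero (ht : 0 < t) :
    imAxisRe E₄ t ^ 3 - imAxisRe E₆ t ^ 2 ≠ 0 := by
  rw [← Complex.ofReal_ne_zero, ofReal_imAxisRe_discriminant ht]
  exact mul_ne_zero (by norm_num) (discriminant_ne_zero _)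

theorem isBigO_imAxisRe_of_isBigO_discriminant {F : ℍ → ℂ} {f : ℝ → ℝ}
    (hF : F =O[atImInfty] discriminant)
    (hf : ∀ t, 0 < t → (f t : ℂ) = F (ofComplex (Complex.I * t))) :
    f =O[atTop] fun t ↦ imAxisRe E₄ t ^ 3 - imAxisRe E₆ t ^ 2 := by
  have h := hF.comp_tendsto tendsto_ofComplex_I_mul
  have h2 : (discriminant ∘ fun t : ℝ ↦ ofComplex (Complex.I * t)) =O[atTop]
      fun t ↦ imAxisRe E₄ t ^ 3 - imAxisRe E₆ t ^ 2 := by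
    refine IsBigO.of_bound 1 ?_
    filter_upwards [eventually_gt_atTop 0] with t ht
    rw [← Complex.norm_real, ofReal_imAxisRe_discriminant ht, norm_mul, Function.comp_apply]
    have := norm_nonneg (discriminant (ofComplex (Complex.I * t)))
    norm_num
    linarith
  refine ((h.trans h2).norm_left.congr' ?_ EventuallyEq.rfl).of_norm_left
  filter_upwards [eventually_gt_atTop 0] with t ht
  rw [Function.comp_apply, ← hf t ht, Complex.norm_real]

theorem imAxisRe_quadratic_form_pos (ht : 0 < t) :
    0 < 49 * imAxisRe E₄ t * (imAxisRe E2 t * imAxisRe E₄ t - imAxisRe E₆ t) ^ 2 -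
      25 * (imAxisRe E₄ t ^ 2 - imAxisRe E2 t * imAxisRe E₆ t) ^ 2 := by
  refine quadratic_form_pos_of_ramanujan_system (fun t ht ↦ hasDerivAt_imAxisRe_E2 ht)
    (fun t ht ↦ hasDerivAt_imAxisRe_E4 ht) (fun t ht ↦ hasDerivAt_imAxisRe_E6 ht)
    (tendsto_imAxisRe tendsto_E2_atImInfty) (tendsto_imAxisRe tendsto_E4_atImInfty)
    (tendsto_imAxisRe tendsto_E6_atImInfty) (fun t ht ↦ imAxisRe_E2_mul_E4_sub_E6_pos ht)
    (fun t ht ↦ imAxisRe_E4_sq_sub_E2_mul_E6_pos ht)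
    (fun t ht ↦ imAxisRe_E4_cube_sub_E6_sq_ne_zero ht)
    (isBigO_imAxisRe_of_isBigO_discriminant E2_mul_E4_sub_E6_isBigO_discriminant
      fun t ht ↦ ?_)
    (isBigO_imAxisRe_of_isBigO_discriminant E4_sq_sub_E2_mul_E6_isBigO_discriminant
      fun t ht ↦ ?_) ht
  · push_cast
    rw [ofReal_imAxisRe_E2 ht, ofReal_imAxisRe_E4 ht, ofReal_imAxisRe_E6 ht]
  · push_cast
    rw [ofReal_imAxisRe_E2 ht, ofReal_imAxisRe_E4 ht, ofReal_imAxisRe_E6 ht]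

end ImaginaryAxis

/-- The value `φ(it)` is a negative real number for every real `t > 0`. -/
theorem lemmaA1 (t : ℝ) (ht : 0 < t) :
    (phi (itPoint t ht)).im = 0 ∧ (phi (itPoint t ht)).re < 0 := by
  have hpt : itPoint t ht = ofComplex (Complex.I * t) := by
    ext
    rw [coe_ofComplex_I_mul ht]
    rfl
  -- The numerator of φ regroups as 25B² - 49E₄A².
  have hval : phi (itPoint t ht) =
      ((-((49 * imAxisRe E₄ t * (imAxisRe E2 t * imAxisRe E₄ t - imAxisRe E₆ t) ^ 2 -
        25 * (imAxisRe E₄ t ^ 2 - imAxisRe E2 t * imAxisRe E₆ t) ^ 2) /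
        ((imAxisRe E₄ t ^ 3 - imAxisRe E₆ t ^ 2) / 1728) ^ 2) : ℝ) : ℂ) := by
    simp only [phi, modularDelta]
    rw [hpt, ← ofReal_imAxisRe_E2 ht, ← ofReal_imAxisRe_E4 ht, ← ofReal_imAxisRe_E6 ht]
    push_cast
    ring
  rw [hval, ofReal_im, ofReal_re]
  have hΔ := imAxisRe_E4_cube_sub_E6_sq_ne_zero ht
  exact ⟨rfl, neg_lt_zero.mpr (div_pos (imAxisRe_quadratic_form_pos ht) (by positivity))⟩
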